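/- Let $\Omega$ be a finite set and let $\mathcal{P}$ be a probability distribution on $\Omega^2$ whose two marginals are equal and which is symmetric, i.e. $\mathcal{P}(x,y)=\mathcal{P}(y,x)$ for all $x,y\in\Omega$. Suppose that $$\alpha(\mathcal{P}) := \min_{x\in\Omega}\mathcal{P}(x,x) > 0 .$$ Then $\mathcal{P}$ is polynomially same-set hitting, that is, there exists a real number $C\ge 0$ (depending only on $\mathcal{P}$) such that for every $\mu\in(0,1]$ the distribution $\mathcal{P}$ is $(\mu,\mu^C)$-same-set hitting, in the following sense: for every integer $n\ge 1$, if the pairs $(X_i,Y_i)$, $i=1,\dots,n$, are independent and each distributed according to $\mathcal{P}$, and $\underline{X}=(X_1,\dots,X_n)$, $\underline{Y}=(Y_1,\dots,Y_n)$, then every function $f:\Omega^n\to[0,1]$ with $\mathbb{E}[f(\underline{X})]\ge\mu$ and $\mathbb{E}[f(\underline{Y})]\ge\mu$ satisfies $$\mathbb{E}\bigl[f(\underline{X})\,f(\underline{Y})\bigr]\ \ge\ \mu^{C}.$$ -/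

import Mathlib

noncomputable section

/-- Expectation `E[g(X)]`, where `X = (X_1, …, X_n)` has i.i.d. coordinates `X_i ∈ Ω^ℓ`, each
distributed according to `P`. For a sample point `x`, the entry `x i j` is the `j`-th step of
the `i`-th coordinate. -/
def tensorExpect {Ω : Type*} [Fintype Ω] {ℓ : ℕ} (P : PMF (Fin ℓ → Ω)) (n : ℕ)
    (g : (Fin n → Fin ℓ → Ω) → ℝ) : ℝ :=
  ∑ x : Fin n → Fin ℓ → Ω, (∏ i, (P (x i)).toReal) * g x

/-- The `j`-th step vector `(X_1^{(j)}, …, X_n^{(j)})` of a sample point. -/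
def stepVector {Ω : Type*} {ℓ n : ℕ} (x : Fin n → Fin ℓ → Ω) (j : Fin ℓ) : Fin n → Ω :=
  fun i => x i j

/-- `P` is `(μ, δ)`-same-set hitting (a notion considered for `μ, δ ∈ (0, 1]`). -/
def IsSameSetHitting {Ω : Type*} [Fintype Ω] {ℓ : ℕ} (P : PMF (Fin ℓ → Ω)) (μ δ : ℝ) : Prop :=
  ∀ n : ℕ, 1 ≤ n → ∀ f : (Fin n → Ω) → ℝ, (∀ ω, f ω ∈ Set.Icc (0 : ℝ) 1) →
    (∀ j : Fin ℓ, μ ≤ tensorExpect P n (fun x => f (stepVector x j))) →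
    δ ≤ tensorExpect P n (fun x => ∏ j : Fin ℓ, f (stepVector x j))

/-- `P` is polynomially same-set hitting: for some `C ≥ 0` it is `(μ, μ^C)`-same-set hitting for
every `μ ∈ (0, 1]`. -/
def IsPolynomiallySameSetHitting {Ω : Type*} [Fintype Ω] {ℓ : ℕ} (P : PMF (Fin ℓ → Ω)) : Prop :=
  ∃ C : ℝ, 0 ≤ C ∧ ∀ μ ∈ Set.Ioc (0 : ℝ) 1, IsSameSetHitting P μ (μ ^ C)

/-- All the one-step marginals of `P` coincide. -/
def HasEqualMarginals {Ω : Type*} {ℓ : ℕ} (P : PMF (Fin ℓ → Ω)) : Prop :=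
  ∀ j k : Fin ℓ, P.map (fun x => x j) = P.map (fun x => x k)

/-- A two-step distribution is symmetric if `P(x, y) = P(y, x)` for all `x, y`. -/
def IsSymmetricTwoStep {Ω : Type*} (P : PMF (Fin 2 → Ω)) : Prop :=
  ∀ x y : Ω, P ![x, y] = P ![y, x]

/-- `α(P) = min_{x ∈ Ω} P(x, x, …, x)`. The infimum is a minimum: `Ω` is finite, and it is
nonempty as soon as `ℓ ≥ 1`, since `P` is a probability distribution. -/
def diagMin {Ω : Type*} [Fintype Ω] {ℓ : ℕ} (P : PMF (Fin ℓ → Ω)) : ℝ :=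
  ⨅ x : Ω, (P (fun _ => x)).toReal

end

/-! Let `π` be the marginal of `P`. Since `P(x,x) ≥ ε ≥ ε π(x)`, `P` is `ε` times the diagonal copy
of `π` plus `1 - ε` times a symmetric law `pairLaw` with marginal `π`. Equivalently, draw an
unordered pair `z` from `pairLaw`, then read its entries off two uniform bits that agree with
probability `ε`. Given `z`, `f` becomes a function on the cube with mean `m z`, and reverse
hypercontractivity (`noiseKernel_cube`) gives at least `m z ^ (2 * 2 ^ k)`. Jensen over `z`
finishes. -/

/-- The weight of a pair of bits in the two-point noise: `ε / 2` on the diagonal and `(1 - ε) / 2`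
off it. -/
noncomputable def noiseKernel (ε : ℝ) (b b' : Bool) : ℝ := if b = b' then ε / 2 else (1 - ε) / 2

theorem pow_midpoint_le {u v : ℝ} (hu : 0 ≤ u) (hv : 0 ≤ v) (c : ℕ) :
    ((u + v) / 2) ^ c ≤ (u ^ c + v ^ c) / 2 := by
  have h := (convexOn_pow (𝕜 := ℝ) c).2 (Set.mem_Ici.2 hu) (Set.mem_Ici.2 hv)
    (by norm_num : (0 : ℝ) ≤ 1 / 2) (by norm_num : (0 : ℝ) ≤ 1 / 2) (by norm_num)
  simp only [smul_eq_mul] at h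
  calc ((u + v) / 2) ^ c = (1 / 2 * u + 1 / 2 * v) ^ c := by ring
    _ ≤ _ := h
    _ = _ := by ring

/-- A homogeneous form of `T_c(p) - 1 ≥ c (p ^ c - 1)` for the Chebyshev polynomials `T_c` with
`c = 2 ^ k` and `p ≥ 1`. -/
theorem two_pow_mul_pow_sub_pow_le {u v g : ℝ} (hu : 0 ≤ u) (hv : 0 ≤ v) (hg : 0 ≤ g)
    (huv : u * v = g ^ 2) (hgm : g ≤ (u + v) / 2) (k : ℕ) :
    2 * 2 ^ k * (((u + v) / 2) ^ 2 ^ k - g ^ 2 ^ k) ≤ u ^ 2 ^ k + v ^ 2 ^ k - 2 * g ^ 2 ^ k := by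
  induction k with
  | zero => simp; linarith
  | succ k ih =>
    have hm := pow_midpoint_le hu hv (2 ^ k)
    have hgm' : g ^ 2 ^ k ≤ ((u + v) / 2) ^ 2 ^ k := pow_le_pow_left₀ hg hgm _
    have hg' : 0 ≤ g ^ 2 ^ k := pow_nonneg hg _
    have huv' : u ^ 2 ^ k * v ^ 2 ^ k = (g ^ 2 ^ k) ^ 2 := by
      rw [← mul_pow, huv, ← pow_mul, ← pow_mul, mul_comm]
    simp only [pow_succ (2 : ℕ) k, pow_mul, pow_succ (2 : ℝ) k]
    -- With `c = 2 ^ k`, `u^(2c) + v^(2c) - 2g^(2c)` factors as `(u^c + v^c - 2g^c)(u^c + v^c +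
    -- 2g^c)`, because `u^c v^c = g^(2c)`.
    have h := mul_le_mul ih
      (by linarith : 2 * (((u + v) / 2) ^ 2 ^ k + g ^ 2 ^ k) ≤
        u ^ 2 ^ k + v ^ 2 ^ k + 2 * g ^ 2 ^ k) (by linarith)
      (le_trans (mul_nonneg (by positivity) (sub_nonneg.2 hgm')) ih)
    nlinarith [h]

/-- The diagonal and off-diagonal products share a geometric mean `g`. The Chebyshev bound amplifies
the light diagonal weight `ε` by `2 ^ k`, enough to match the weight `1 / 2` left by convexity. -/
theorem noiseKernel_two_point {ε : ℝ} (hε₂ : ε ≤ 1 / 2) {k : ℕ} (hk : 1 ≤ 2 * ε * 2 ^ k)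
    {a b : Bool → ℝ} (ha : ∀ i, 0 ≤ a i) (hb : ∀ i, 0 ≤ b i) :
    ((∑ i, 1 / 2 * a i) * (∑ i, 1 / 2 * b i)) ^ 2 ^ k ≤
      ∑ i, ∑ j, noiseKernel ε i j * (a i * b j) ^ 2 ^ k := by
  simp only [Fintype.sum_bool, noiseKernel]
  simp only [reduceCtorEq, if_true, if_false]
  have h11 := mul_nonneg (ha true) (hb true)
  have h00 := mul_nonneg (ha false) (hb false)
  have h10 := mul_nonneg (ha true) (hb false)
  have h01 := mul_nonneg (ha false) (hb true)
  have hprod : (a true * b false) * (a false * b true) =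
      (a true * b true) * (a false * b false) := by ring
  have hmid : (1 / 2 * a true + 1 / 2 * a false) * (1 / 2 * b true + 1 / 2 * b false) =
      ((a true * b true + a false * b false) / 2 + (a true * b false + a false * b true) / 2) / 2 := by
    ring
  rw [hmid]
  generalize a true * b true = u at *
  generalize a false * b false = v at *
  generalize a true * b false = w at *
  generalize a false * b true = w' at *
  have hg := Real.sqrt_nonneg (u * v)
  have hsq : u * v = √(u * v) ^ 2 := (Real.sq_sqrt (mul_nonneg h11 h00)).symm
  generalize √(u * v) = g at *
  have hgm : g ≤ (u + v) / 2 := abs_le_of_sq_le_sq' (by nlinarith [sq_nonneg (u - v)])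
    (by positivity) |>.2
  have hgm' : g ≤ (w + w') / 2 := abs_le_of_sq_le_sq' (by nlinarith [sq_nonneg (w - w')])
    (by positivity) |>.2
  have h1 := two_pow_mul_pow_sub_pow_le h11 h00 hg hsq hgm k
  have h2 := pow_midpoint_le h10 h01 (2 ^ k)
  have h3 := pow_midpoint_le (u := (u + v) / 2) (v := (w + w') / 2)
    (by positivity) (by positivity) (2 ^ k)
  have h4 : g ^ 2 ^ k ≤ ((u + v) / 2) ^ 2 ^ k := pow_le_pow_left₀ hg hgm _
  have h5 : g ^ 2 ^ k ≤ ((w + w') / 2) ^ 2 ^ k := pow_le_pow_left₀ hg hgm' _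
  have hε : 0 < ε := by
    by_contra h
    have : ε * 2 ^ k ≤ 0 := mul_nonpos_of_nonpos_of_nonneg (not_lt.1 h) (by positivity)
    linarith
  have h6 := mul_le_mul_of_nonneg_left h1 hε.le
  have h7 := mul_le_mul_of_nonneg_right hk (sub_nonneg.2 h4)
  have h8 := mul_le_mul_of_nonneg_left h2 (by linarith : 0 ≤ 1 - ε)
  -- The surplus left after the other bounds; this is where `ε ≤ 1 / 2` enters.
  have h9 := mul_nonneg (by linarith : 0 ≤ 1 / 2 - ε) (sub_nonneg.2 h5)
  linarith

theorem sum_fin_succ_arrow {α : Type*} [Fintype α] (n : ℕ) (F : (Fin (n + 1) → α) → ℝ) :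
    ∑ x, F x = ∑ a, ∑ x : Fin n → α, F (Fin.cons a x) := by
  rw [← (Fin.consEquiv fun _ : Fin (n + 1) => α).sum_comp, Fintype.sum_prod_type]
  rfl

theorem noiseKernel_nonneg {ε : ℝ} (hε : 0 ≤ ε) (hε₁ : ε ≤ 1) (b b' : Bool) :
    0 ≤ noiseKernel ε b b' := by
  unfold noiseKernel; split_ifs <;> linarith

theorem sum_noiseKernel (ε : ℝ) (b : Bool) : ∑ b', noiseKernel ε b b' = 1 / 2 := by
  cases b <;> simp [noiseKernel] <;> ring

/-- Reverse hypercontractivity on the discrete cube, for `[0, 1]`-valued functions. -/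
theorem noiseKernel_cube {ε : ℝ} (hε : 0 ≤ ε) (hε₂ : ε ≤ 1 / 2) {k : ℕ}
    (hk : 1 ≤ 2 * ε * 2 ^ k) (n : ℕ) (F G : (Fin n → Bool) → ℝ)
    (hF : ∀ x, F x ∈ Set.Icc (0 : ℝ) 1) (hG : ∀ x, G x ∈ Set.Icc (0 : ℝ) 1) :
    ((∑ x, (1 / 2) ^ n * F x) * (∑ y, (1 / 2) ^ n * G y)) ^ 2 ^ k ≤
      ∑ x, ∑ y, (∏ i, noiseKernel ε (x i) (y i)) * (F x * G y) := by
  induction n with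
  | zero =>
    simp only [Fintype.sum_unique, pow_zero, one_mul, Finset.univ_eq_empty, Finset.prod_empty]
    -- Only the base case needs values at most 1.
    exact pow_le_of_le_one (mul_nonneg (hF _).1 (hG _).1)
      (mul_le_one₀ (hF _).2 (hG _).1 (hG _).2) (by positivity)
  | succ n ih =>
    have hsplit (F : (Fin (n + 1) → Bool) → ℝ) : ∑ x, (1 / 2 : ℝ) ^ (n + 1) * F x =
        ∑ a, 1 / 2 * ∑ x : Fin n → Bool, (1 / 2) ^ n * F (Fin.cons a x) := by
      rw [sum_fin_succ_arrow]
      simp only [Finset.mul_sum, pow_succ', mul_assoc]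
    have hrhs : ∑ x, ∑ y, (∏ i, noiseKernel ε (x i) (y i)) * (F x * G y) =
        ∑ a, ∑ b, noiseKernel ε a b * ∑ x : Fin n → Bool, ∑ y : Fin n → Bool,
          (∏ i, noiseKernel ε (x i) (y i)) * (F (Fin.cons a x) * G (Fin.cons b y)) := by
      rw [sum_fin_succ_arrow]
      refine Finset.sum_congr rfl fun a _ => ?_
      simp only [sum_fin_succ_arrow n, Finset.mul_sum]
      rw [Finset.sum_comm]
      simp only [Fin.prod_univ_succ, Fin.cons_zero, Fin.cons_succ, mul_assoc]
    rw [hsplit F, hsplit G, hrhs]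
    refine (noiseKernel_two_point hε₂ hk
      (fun a => Finset.sum_nonneg fun x _ => mul_nonneg (by positivity) (hF _).1)
      (fun a => Finset.sum_nonneg fun x _ => mul_nonneg (by positivity) (hG _).1)).trans ?_
    refine Finset.sum_le_sum fun a _ => Finset.sum_le_sum fun b _ =>
      mul_le_mul_of_nonneg_left ?_ (noiseKernel_nonneg hε (by linarith) a b)
    exact ih _ _ (fun x => hF _) (fun x => hG _)

theorem sum_prod_noiseKernel (ε : ℝ) (n : ℕ) (F : (Fin n → Bool) → ℝ) :
    ∑ x, ∑ y : Fin n → Bool, (∏ i, noiseKernel ε (x i) (y i)) * F x =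
      ∑ x, (1 / 2) ^ n * F x := by
  refine Finset.sum_congr rfl fun x _ => ?_
  rw [← Finset.sum_mul, ← Fintype.prod_sum]
  simp only [sum_noiseKernel, Finset.prod_const, Finset.card_univ, Fintype.card_fin]

/-- If `P` is the image of a weight `W` on `ι` under `φ`, then expectations with respect to powers
of `P` can be computed on powers of `ι`. -/
theorem tensorExpect_eq_sum_of_image {Ω ι : Type*} [Fintype Ω] [Fintype ι] [DecidableEq Ω] {ℓ : ℕ}
    (P : PMF (Fin ℓ → Ω)) (W : ι → ℝ) (φ : ι → Fin ℓ → Ω)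
    (hP : ∀ v, (P v).toReal = ∑ w, W w * if φ w = v then 1 else 0) (n : ℕ)
    (g : (Fin n → Fin ℓ → Ω) → ℝ) :
    tensorExpect P n g = ∑ w : Fin n → ι, (∏ i, W (w i)) * g fun i => φ (w i) := by
  unfold tensorExpect
  simp only [hP, Fintype.prod_sum, Finset.sum_mul]
  rw [Finset.sum_comm]
  refine Finset.sum_congr rfl fun w _ => ?_
  rw [Finset.sum_eq_single fun i => φ (w i)]
  · simp
  · intro x _ hx
    obtain ⟨i, hi⟩ := Function.ne_iff.1 hx
    rw [Finset.prod_eq_zero (Finset.mem_univ i), zero_mul]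
    simp [hi.symm]
  · simp

/-- The law of the pair of points in the decomposition of a symmetric two-step distribution
as a mixture of noisy two-point distributions. -/
noncomputable def pairLaw {Ω : Type*} [Fintype Ω] [DecidableEq Ω] (P : PMF (Fin 2 → Ω)) (ε : ℝ)
    (z : Ω × Ω) : ℝ :=
  ((P ![z.1, z.2]).toReal - if z.1 = z.2 then ε * ∑ y, (P ![z.1, y]).toReal else 0) / (1 - ε)

theorem sum_toReal_two_step {Ω : Type*} [Fintype Ω] (P : PMF (Fin 2 → Ω)) :
    ∑ x, ∑ y, (P ![x, y]).toReal = 1 := by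
  have h : ∑ v, (P v).toReal = 1 := by
    rw [← ENNReal.toReal_sum fun v _ => P.apply_ne_top v, ← tsum_fintype (L := .unconditional _),
      P.tsum_coe, ENNReal.toReal_one]
  rw [← h, ← (finTwoArrowEquiv Ω).symm.sum_comp, Fintype.sum_prod_type]
  rfl

section pairLaw

variable {Ω : Type*} [Fintype Ω] [DecidableEq Ω] (P : PMF (Fin 2 → Ω)) {ε : ℝ}

theorem pairLaw_nonneg (hε : 0 ≤ ε) (hε₁ : ε < 1) (hdiag : ∀ x, ε ≤ (P ![x, x]).toReal)
    (z : Ω × Ω) : 0 ≤ pairLaw P ε z := by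
  refine div_nonneg ?_ (by linarith)
  split_ifs with h
  · have h1 : ∑ y, (P ![z.1, y]).toReal ≤ 1 := by
      rw [← sum_toReal_two_step P]
      exact Finset.single_le_sum (f := fun x => ∑ y, (P ![x, y]).toReal)
        (fun x _ => Finset.sum_nonneg fun y _ => ENNReal.toReal_nonneg) (Finset.mem_univ _)
    have h2 := hdiag z.1
    rw [← h]
    nlinarith [mul_le_mul_of_nonneg_left h1 hε]
  · simp

theorem sum_pairLaw_right (hε₁ : ε < 1) (x : Ω) :
    ∑ y, pairLaw P ε (x, y) = ∑ y, (P ![x, y]).toReal := by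
  have : 1 - ε ≠ 0 := by linarith
  simp only [pairLaw, ← Finset.sum_div, Finset.sum_sub_distrib, Finset.sum_ite_eq,
    Finset.mem_univ, if_true]
  field_simp

theorem pairLaw_swap (hsymm : IsSymmetricTwoStep P) (x y : Ω) :
    pairLaw P ε (x, y) = pairLaw P ε (y, x) := by
  by_cases h : x = y
  · rw [h]
  · simp [pairLaw, h, Ne.symm h, hsymm x y]

theorem toReal_eq_sum_pairLaw (hsymm : IsSymmetricTwoStep P) (hε₁ : ε < 1) (v : Fin 2 → Ω) :
    (P v).toReal = ∑ w : (Ω × Ω) × (Bool × Bool), pairLaw P ε w.1 * noiseKernel ε w.2.1 w.2.2 *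
      if ![cond w.2.1 w.1.1 w.1.2, cond w.2.2 w.1.1 w.1.2] = v then 1 else 0 := by
  obtain ⟨s, t, rfl⟩ : ∃ s t, v = ![s, t] := ⟨v 0, v 1, by ext i; fin_cases i <;> rfl⟩
  have h1 : 1 - ε ≠ 0 := by linarith
  have hiff (a b : Ω) : (![a, b] = ![s, t]) ↔ a = s ∧ b = t := by simp
  have hoff : ∑ x, ∑ y, pairLaw P ε (x, y) * (if x = s ∧ y = t then 1 else 0) =
      pairLaw P ε (s, t) := by
    simp [ite_and]
  have hoff' : ∑ x, ∑ y, pairLaw P ε (x, y) * (if y = s ∧ x = t then 1 else 0) =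
      pairLaw P ε (s, t) := by
    simp [ite_and, pairLaw_swap P hsymm s t]
  have hdiag : ∑ x, ∑ y, pairLaw P ε (x, y) * (if x = s ∧ x = t then 1 else 0) =
      if s = t then ∑ y, (P ![s, y]).toReal else 0 := by
    simp_rw [← Finset.sum_mul, sum_pairLaw_right P hε₁]
    simp [ite_and]
  have hdiag' : ∑ x, ∑ y, pairLaw P ε (x, y) * (if y = s ∧ y = t then 1 else 0) =
      if s = t then ∑ y, (P ![s, y]).toReal else 0 := by
    rw [Finset.sum_comm, ← hdiag]
    simp_rw [pairLaw_swap P hsymm]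
  -- One term for each of the four bit pairs.
  have hsum : (P ![s, t]).toReal = ε / 2 * (if s = t then ∑ y, (P ![s, y]).toReal else 0) +
      ε / 2 * (if s = t then ∑ y, (P ![s, y]).toReal else 0) +
      (1 - ε) / 2 * pairLaw P ε (s, t) + (1 - ε) / 2 * pairLaw P ε (s, t) := by
    simp only [pairLaw]
    split_ifs <;> field_simp <;> ring
  rw [hsum]
  nth_rewrite 1 [← hdiag]
  rw [← hdiag']
  nth_rewrite 1 [← hoff]
  rw [← hoff']
  simp only [Fintype.sum_prod_type, Fintype.sum_bool, noiseKernel, cond_true, cond_false, hiff,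
    reduceCtorEq, if_true, if_false, Finset.mul_sum, ← Finset.sum_add_distrib]
  refine Finset.sum_congr rfl fun x _ => Finset.sum_congr rfl fun y _ => ?_
  ring

theorem tensorExpect_eq_sum_pairLaw (hsymm : IsSymmetricTwoStep P) (hε₁ : ε < 1) (n : ℕ)
    (g : (Fin n → Ω) → (Fin n → Ω) → ℝ) :
    tensorExpect P n (fun x => g (stepVector x 0) (stepVector x 1)) =
      ∑ z : Fin n → Ω × Ω, (∏ i, pairLaw P ε (z i)) * ∑ x : Fin n → Bool, ∑ y : Fin n → Bool,
        (∏ i, noiseKernel ε (x i) (y i)) *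
          g (fun i => cond (x i) (z i).1 (z i).2) (fun i => cond (y i) (z i).1 (z i).2) := by
  rw [tensorExpect_eq_sum_of_image P _ _ (toReal_eq_sum_pairLaw P hsymm hε₁),
    ← (Equiv.arrowProdEquivProdArrow (Fin n) (fun _ => Ω × Ω) fun _ => Bool × Bool).symm.sum_comp,
    Fintype.sum_prod_type]
  refine Finset.sum_congr rfl fun z _ => ?_
  rw [← (Equiv.arrowProdEquivProdArrow (Fin n) (fun _ => Bool) fun _ => Bool).symm.sum_comp,
    Fintype.sum_prod_type, Finset.mul_sum]
  refine Finset.sum_congr rfl fun x _ => ?_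
  rw [Finset.mul_sum]
  refine Finset.sum_congr rfl fun y _ => ?_
  rw [← mul_assoc, ← Finset.prod_mul_distrib]
  rfl

theorem sum_prod_pairLaw (hε₁ : ε < 1) (n : ℕ) :
    ∑ z : Fin n → Ω × Ω, ∏ i, pairLaw P ε (z i) = 1 := by
  rw [← Fintype.prod_sum]
  simp [Fintype.sum_prod_type, sum_pairLaw_right P hε₁, sum_toReal_two_step P]

end pairLaw

theorem mainTheorem8 {Ω : Type*} [Fintype Ω] (P : PMF (Fin 2 → Ω))
    (hmarg : HasEqualMarginals P) (hsymm : IsSymmetricTwoStep P) (hα : 0 < diagMin P) :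
    IsPolynomiallySameSetHitting P := by
  classical
  -- The cap at `1 / 2` serves the two-point inequality.
  set ε : ℝ := min (diagMin P) (1 / 2) with hεdef
  have hε : 0 < ε := lt_min hα (by norm_num)
  have hε₂ : ε ≤ 1 / 2 := min_le_right _ _
  have hε₁ : ε < 1 := by linarith
  have hdiag (x : Ω) : ε ≤ (P ![x, x]).toReal := by
    have hx : ![x, x] = fun _ : Fin 2 => x := by ext i; fin_cases i <;> rfl
    rw [hx]
    exact (min_le_left _ _).trans (ciInf_le (Set.finite_range _).bddBelow x)
  obtain ⟨k, hk⟩ : ∃ k : ℕ, 1 ≤ 2 * ε * 2 ^ k := by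
    obtain ⟨k, hk⟩ := pow_unbounded_of_one_lt (1 / (2 * ε)) (one_lt_two (α := ℝ))
    rw [div_lt_iff₀' (by positivity)] at hk
    exact ⟨k, hk.le⟩
  -- The factor 2 arises because both cube functions have the same mean `m z`.
  refine ⟨((2 * 2 ^ k : ℕ) : ℝ), by positivity, fun μ hμ n _ f hf hmean => ?_⟩
  rw [Real.rpow_natCast]
  set m : (Fin n → Ω × Ω) → ℝ := fun z =>
    ∑ x : Fin n → Bool, (1 / 2) ^ n * f fun i => cond (x i) (z i).1 (z i).2
  have hm (z) : 0 ≤ m z := Finset.sum_nonneg fun x _ => mul_nonneg (by positivity) (hf _).1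
  have hQ (z : Fin n → Ω × Ω) : 0 ≤ ∏ i, pairLaw P ε (z i) :=
    Finset.prod_nonneg fun i _ => pairLaw_nonneg P hε.le hε₁ hdiag _
  have hμm : μ ≤ ∑ z : Fin n → Ω × Ω, (∏ i, pairLaw P ε (z i)) * m z := by
    refine (hmean 0).trans_eq ?_
    rw [tensorExpect_eq_sum_pairLaw P hsymm hε₁ n fun x _ => f x]
    exact Finset.sum_congr rfl fun z _ => congrArg _ (sum_prod_noiseKernel ε n _)
  simp only [Fin.prod_univ_two]
  rw [tensorExpect_eq_sum_pairLaw P hsymm hε₁ n fun x y => f x * f y]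
  calc μ ^ (2 * 2 ^ k) ≤ (∑ z, (∏ i, pairLaw P ε (z i)) * m z) ^ (2 * 2 ^ k) :=
        pow_le_pow_left₀ hμ.1.le hμm _
    _ ≤ ∑ z, (∏ i, pairLaw P ε (z i)) * m z ^ (2 * 2 ^ k) :=
        Real.pow_arith_mean_le_arith_mean_pow _ _ _ (fun z _ => hQ z)
          (sum_prod_pairLaw P hε₁ n) (fun z _ => hm z) _
    _ ≤ _ := Finset.sum_le_sum fun z _ => mul_le_mul_of_nonneg_left ?_ (hQ z)
  rw [pow_mul, pow_two]
  exact noiseKernel_cube hε.le hε₂ hk n _ _ (fun _ => hf _) fun _ => hf _
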